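/- All monoids are commutative and written additively. For a monoid $M$, let $M^{gp}$ be its group completion, with canonical map $M \to M^{gp}$. $M$ is integral if it is cancellative; fine if it is integral and finitely generated; sharp if its only invertible element is $0$; saturated if it is integral and every $x \in M^{gp}$ such that $nx$ lies in (the image of) $M$ for some integer $n \geq 1$ itself lies in (the image of) $M$. A submonoid $P$ of a monoid $M$ is exact if the square formed by the inclusion $P \to M$, the induced map $P^{gp} \to M^{gp}$ and the canonical maps $P \to P^{gp}$, $M \to M^{gp}$ is cartesian. Let $Q$ be a fine sharp monoid. Then: 1. $Q$ is isomorphic to a submonoid of $\mathbb{N}^r \oplus T$ for some $r \in \mathbb{N}$ and some finite abelian group $T$. 2. If $Q^{gp}$ is torsion-free, one can take $T = 0$, i.e. $Q$ is isomorphic to a submonoid of $\mathbb{N}^r$ for some $r \in \mathbb{N}$. 3. If $Q$ is saturated, then $Q$ is isomorphic to an exact submonoid of $\mathbb{N}^r$ for some $r \in \mathbb{N}$. -/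

import Mathlib

open Algebra

namespace CommMonoidGeometry

/-- A commutative monoid (written additively) is sharp if its only unit is `0`. -/
def IsSharp (M : Type*) [AddCommMonoid M] : Prop :=
  ∀ m : M, IsAddUnit m → m = 0

/-- A commutative monoid is fine if it is integral (cancellative) and finitely generated. -/
structure IsFine (M : Type*) [AddCommMonoid M] : Prop where
  integral : IsCancelAdd M
  fg : AddMonoid.FG M

/-- A commutative monoid `M` is saturated if it is integral and every `x` in its group completion
with a positive multiple in (the image of) `M` lies in (the image of) `M`. -/
structure IsSaturated (M : Type*) [AddCommMonoid M] : Prop where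
  integral : IsCancelAdd M
  mem_of_nsmul_mem : ∀ (n : ℕ) (x : GrothendieckAddGroup M), 0 < n →
    n • x ∈ Set.range (GrothendieckAddGroup.of (M := M)) →
      x ∈ Set.range (GrothendieckAddGroup.of (M := M))

/-- The homomorphism `P^gp → Q^gp` induced by a homomorphism of monoids `P → Q`. -/
noncomputable def gpMap {P Q : Type*} [AddCommMonoid P] [AddCommMonoid Q] (θ : P →+ Q) :
    GrothendieckAddGroup P →+ GrothendieckAddGroup Q :=
  GrothendieckAddGroup.lift ((GrothendieckAddGroup.of (M := Q)).comp θ)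

/-- A homomorphism `θ : P → Q` is exact if the square formed by `θ`, `θ^gp` and the canonical maps
`P → P^gp`, `Q → Q^gp` is cartesian, i.e. `P → P^gp ×_{Q^gp} Q` is bijective. -/
def IsExact {P Q : Type*} [AddCommMonoid P] [AddCommMonoid Q] (θ : P →+ Q) : Prop :=
  ∀ (x : GrothendieckAddGroup P) (q : Q), gpMap θ x = GrothendieckAddGroup.of q →
    ∃! p : P, GrothendieckAddGroup.of p = x ∧ θ p = q

/-- A submonoid is exact if its inclusion homomorphism is exact. -/
def IsExactSubmonoid {M : Type*} [AddCommMonoid M] (S : AddSubmonoid M) : Prop :=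
  IsExact S.subtype

end CommMonoidGeometry

namespace CommMonoidGeometry

/-! By Minkowski-Weyl (`exists_finset_nonneg_iff_nsmul_mem_closure`), finitely many integral
functionals cut out the saturation of `Q` in its group completion. Their values map `Q` to ℕ^r. By
sharpness, two elements with the same image differ by torsion, so recording the torsion component as
well restores injectivity. If `Q` is saturated, there is no torsion and the inequalities cut out `Q`
itself, which makes the image closed under differences, hence exact. -/

/-- A finitely generated abelian group is a product of a free group and a finite group. -/
theorem exists_addEquiv_free_prod_finite (G : Type*) [AddCommGroup G] [AddGroup.FG G] :
    ∃ (n : ℕ) (T : Type) (_ : AddCommGroup T) (_ : Finite T),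
      Nonempty (G ≃+ (Fin n →₀ ℤ) × T) := by
  obtain ⟨n, ι, _, p, hp, e, ⟨φ⟩⟩ := AddCommGroup.equiv_free_prod_directSum_zmod G
  have (i : ι) : NeZero (p i ^ e i) := ⟨pow_ne_zero _ (hp i).ne_zero⟩
  classical
  exact ⟨n, DirectSum ι fun i => ZMod (p i ^ e i), inferInstance,
    Finite.of_equiv _ (DirectSum.addEquivProd fun i => ZMod (p i ^ e i)).symm.toEquiv, ⟨φ⟩⟩

/-- The torsion of a finitely generated abelian group is cut out by finitely many inequalities. -/
theorem exists_finset_nonneg_iff_torsion (G : Type*) [AddCommGroup G] [AddGroup.FG G] :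
    ∃ F : Finset (G →+ ℤ), ∀ x : G,
      (∀ f ∈ F, 0 ≤ f x) ↔ ∃ n : ℕ, 0 < n ∧ n • x = 0 := by
  classical
  obtain ⟨n, T, _, _, ⟨e⟩⟩ := exists_addEquiv_free_prod_finite G
  let c (i : Fin n) : G →+ ℤ :=
    (Finsupp.applyAddHom i).comp ((AddMonoidHom.fst (Fin n →₀ ℤ) T).comp e.toAddMonoidHom)
  refine ⟨Finset.univ.image c ∪ Finset.univ.image fun i => -c i, fun x => ⟨fun h => ?_, ?_⟩⟩
  · refine ⟨Nat.card T, Nat.card_pos, e.injective ?_⟩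
    have hx : (e x).1 = 0 := by
      ext i
      have h₁ := h (c i) (by simp)
      have h₂ := h (-c i) (by simp)
      exact le_antisymm (neg_nonneg.mp h₂) h₁
    rw [map_nsmul, map_zero]
    ext1
    · simp [hx]
    · exact card_nsmul_eq_zero'
  · rintro ⟨m, hm, hx⟩ f -
    have : m • f x = 0 := by rw [← map_nsmul, hx, map_zero]
    exact ((smul_eq_zero.mp this).resolve_left hm.ne').ge

/-- The Minkowski-Weyl theorem over `ℤ`: the saturation of a finitely generated submonoid of a
finitely generated abelian group is cut out by finitely many inequalities. -/
theorem exists_finset_nonneg_iff_nsmul_mem_closure {G : Type*} [AddCommGroup G] [AddGroup.FG G]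
    (s : Finset G) :
    ∃ F : Finset (G →+ ℤ), ∀ x : G,
      (∀ f ∈ F, 0 ≤ f x) ↔ ∃ n : ℕ, 0 < n ∧ n • x ∈ AddSubmonoid.closure (s : Set G) := by
  classical
  induction s using Finset.induction_on with
  | empty => simpa using exists_finset_nonneg_iff_torsion G
  | insert a s _ ih =>
    obtain ⟨F, hF⟩ := ih
    have hmem {x : G} (hx : x ∈ AddSubmonoid.closure (s : Set G)) :
        x ∈ AddSubmonoid.closure ((insert a s : Finset G) : Set G) :=
      AddSubmonoid.closure_mono (by simp) hx
    have ha : a ∈ AddSubmonoid.closure ((insert a s : Finset G) : Set G) :=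
      AddSubmonoid.subset_closure (by simp)
    -- Fourier-Motzkin elimination: each pair with opposite signs at `a` contributes its positive
    -- combination vanishing at `a`.
    refine ⟨F.filter (fun f => 0 ≤ f a) ∪
      ((F.filter fun f => 0 < f a) ×ˢ (F.filter fun g => g a < 0)).image
        (fun q => q.1 a • q.2 - q.2 a • q.1), fun x => ⟨fun h => ?_, ?_⟩⟩
    · have h₀ : ∀ f ∈ F, 0 ≤ f a → 0 ≤ f x := fun f hf hfa => h f (by simp [hf, hfa])
      have h₁ : ∀ f ∈ F, 0 < f a → ∀ g ∈ F, g a < 0 → 0 ≤ f a * g x - g a * f x := by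
        intro f hf hfa g hg hga
        have := h (f a • g - g a • f) (Finset.mem_union_right _
          (Finset.mem_image.mpr ⟨(f, g), by simp [hf, hg, hfa, hga], rfl⟩))
        simpa using this
      obtain hN | hN := (F.filter fun g => g a < 0 ∧ g x < 0).eq_empty_or_nonempty
      · obtain ⟨n, hn, hnx⟩ := (hF x).mp fun f hf => by
          by_contra! hfx
          have hfa : f a < 0 := by
            by_contra! hfa
            exact hfx.not_ge (h₀ f hf hfa)
          exact Finset.eq_empty_iff_forall_notMem.mp hN f (by simp [hf, hfa, hfx])
        exact ⟨n, hn, hmem hnx⟩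
      -- Seek `t ≥ 0` with `x - t a` in the old cone. Those `f` with `f a < 0` require `t ≥ f x / f
      -- a`; the least such `t` is `g x / g a = k / m`. The combined functionals ensure that it is
      -- not too large for those with `f a > 0`.
      · obtain ⟨g, hg, hmax⟩ := Finset.exists_max_image _ (fun g => (g x : ℚ) / g a) hN
        simp only [Finset.mem_filter] at hg hmax
        obtain ⟨hg, hga, hgx⟩ := hg
        obtain ⟨m, hm⟩ := Int.eq_ofNat_of_zero_le (neg_nonneg.mpr hga.le)
        obtain ⟨k, hk⟩ := Int.eq_ofNat_of_zero_le (neg_nonneg.mpr hgx.le)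
        obtain ⟨n, hn, hnx⟩ := (hF (m • x - k • a)).mp fun f hf => by
          have hval : f (m • x - k • a) = g x * f a - g a * f x := by
            rw [map_sub, map_nsmul, map_nsmul, nsmul_eq_mul, nsmul_eq_mul, ← hm, ← hk]
            ring
          rw [hval]
          obtain hfa | hfa | hfa := lt_trichotomy (f a) 0
          · obtain hfx | hfx := lt_or_ge (f x) 0
            · have := hmax f ⟨hf, hfa, hfx⟩
              have hfa' : (f a : ℚ) < 0 := by exact_mod_cast hfa
              have hga' : (g a : ℚ) < 0 := by exact_mod_cast hga
              rw [div_le_iff_of_neg hfa', div_mul_eq_mul_div, div_le_iff_of_neg hga'] at this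
              have : g x * f a ≥ f x * g a := by exact_mod_cast this
              linarith
            · nlinarith
          · have := h₀ f hf hfa.ge
            rw [hfa]
            nlinarith
          · linarith [h₁ f hf hfa g hg hga]
        refine ⟨n * m, Nat.mul_pos hn (by lia), ?_⟩
        have : (n * m) • x = n • (m • x - k • a) + (n * k) • a := by
          rw [nsmul_sub, mul_nsmul', mul_nsmul', sub_add_cancel]
        rw [this]
        exact add_mem (hmem hnx) (nsmul_mem ha _)
    · rintro ⟨n, hn, hnx⟩
      rw [Finset.coe_insert, Set.insert_eq, AddSubmonoid.closure_union, AddSubmonoid.mem_sup] at hnx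
      obtain ⟨y, hy, z, hz, hyz⟩ := hnx
      obtain ⟨k, rfl⟩ := AddSubmonoid.mem_closure_singleton.mp hy
      have hz' : ∀ f ∈ F, 0 ≤ f z := (hF z).mpr ⟨1, one_pos, by simpa using hz⟩
      have hx (f : G →+ ℤ) : n * f x = k * f a + f z := by
        have := congrArg f hyz
        simpa using this.symm
      have hn' : (0 : ℤ) < n := by exact_mod_cast hn
      intro f hf
      refine nonneg_of_mul_nonneg_right (b := f x) ?_ hn'
      rw [hx]
      simp only [Finset.mem_union, Finset.mem_filter, Finset.mem_image, Finset.mem_product] at hf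
      obtain ⟨hf, hfa⟩ | ⟨⟨f, g⟩, ⟨⟨hf, hfa⟩, hg, hga⟩, rfl⟩ := hf
      · have := hz' f hf
        positivity
      · simp only [AddMonoidHom.sub_apply, AddMonoidHom.smul_apply, smul_eq_mul]
        nlinarith [mul_nonneg hfa.le (hz' g hg), mul_nonneg (neg_nonneg.mpr hga.le) (hz' f hf)]

/-- The saturation of a fine monoid in its group completion is cut out by finitely many
inequalities. -/
theorem IsFine.exists_nonneg_iff_nsmul_mem_range {Q : Type*} [AddCommMonoid Q] (h : IsFine Q) :
    ∃ (r : ℕ) (φ : Fin r → GrothendieckAddGroup Q →+ ℤ), ∀ x : GrothendieckAddGroup Q,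
      (∀ i, 0 ≤ φ i x) ↔
        ∃ n : ℕ, 0 < n ∧ n • x ∈ Set.range (GrothendieckAddGroup.of (M := Q)) := by
  classical
  have := h.fg
  obtain ⟨s, hs⟩ := AddMonoid.FG.fg_top (M := Q)
  have : AddGroup.FG (GrothendieckAddGroup Q) := AddGroup.fg_iff_addMonoid_fg.mpr inferInstance
  obtain ⟨F, hF⟩ := exists_finset_nonneg_iff_nsmul_mem_closure
    (s.image (GrothendieckAddGroup.of (M := Q)))
  refine ⟨F.card, fun i => F.equivFin.symm i, fun x => ?_⟩
  have hcl : (AddSubmonoid.closure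
      ((s.image (GrothendieckAddGroup.of (M := Q)) : Finset _) : Set (GrothendieckAddGroup Q)) :
        Set (GrothendieckAddGroup Q)) = Set.range (GrothendieckAddGroup.of (M := Q)) := by
    rw [Finset.coe_image, ← AddMonoidHom.map_mclosure, hs, ← AddMonoidHom.mrange_eq_map,
      AddMonoidHom.coe_mrange]
  rw [← hcl]
  refine Iff.trans ⟨fun h f hf => ?_, fun h i => h _ (F.equivFin.symm i).2⟩ (hF x)
  simpa using h (F.equivFin ⟨f, hf⟩)

/-- In the group completion of a sharp cancellative monoid, an element which lies in the monoid
together with its opposite vanishes. -/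
theorem IsSharp.eq_zero_of_mem_range {Q : Type*} [AddCommMonoid Q] [IsCancelAdd Q]
    (h : IsSharp Q) {x : GrothendieckAddGroup Q}
    (hx : x ∈ Set.range (GrothendieckAddGroup.of (M := Q)))
    (hx' : -x ∈ Set.range (GrothendieckAddGroup.of (M := Q))) : x = 0 := by
  obtain ⟨p, rfl⟩ := hx
  obtain ⟨q, hq⟩ := hx'
  have hpq : p + q = 0 := GrothendieckAddGroup.of_injective (by rw [map_add, hq, map_zero,
    add_neg_cancel])
  rw [h p (.of_add_eq_zero q hpq), map_zero]

/-- In the group completion of a sharp cancellative monoid, an element which lies in the saturation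
together with its opposite is torsion. -/
theorem IsSharp.exists_nsmul_eq_zero {Q : Type*} [AddCommMonoid Q] [IsCancelAdd Q]
    (h : IsSharp Q) {x : GrothendieckAddGroup Q}
    (hx : ∃ n : ℕ, 0 < n ∧ n • x ∈ Set.range (GrothendieckAddGroup.of (M := Q)))
    (hx' : ∃ n : ℕ, 0 < n ∧ n • -x ∈ Set.range (GrothendieckAddGroup.of (M := Q))) :
    ∃ n : ℕ, 0 < n ∧ n • x = 0 := by
  obtain ⟨m, hm, p, hp⟩ := hx
  obtain ⟨n, hn, q, hq⟩ := hx'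
  refine ⟨m * n, Nat.mul_pos hm hn, h.eq_zero_of_mem_range ⟨n • p, ?_⟩ ⟨m • q, ?_⟩⟩
  · rw [map_nsmul, hp, mul_nsmul]
  · rw [map_nsmul, hq, ← smul_neg, mul_nsmul']

/-- The group completion of a sharp saturated monoid is torsion-free. -/
theorem IsSaturated.eq_zero_of_nsmul_eq_zero {Q : Type*} [AddCommMonoid Q]
    (hsat : IsSaturated Q) (h : IsSharp Q) {x : GrothendieckAddGroup Q} {n : ℕ} (hn : 0 < n)
    (hx : n • x = 0) : x = 0 := by
  have := hsat.integral
  exact h.eq_zero_of_mem_range (hsat.mem_of_nsmul_mem n x hn ⟨0, by rw [hx, map_zero]⟩)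
    (hsat.mem_of_nsmul_mem n (-x) hn ⟨0, by rw [smul_neg, hx, neg_zero, map_zero]⟩)

/-- The element-wise form of the fact that every element of a group completion is a difference. -/
theorem exists_of_sub_of_eq {M : Type*} [AddCommMonoid M] (x : GrothendieckAddGroup M) :
    ∃ p q : M, GrothendieckAddGroup.of p - GrothendieckAddGroup.of q = x := by
  obtain ⟨⟨p, q⟩, h⟩ := (AddLocalization.addMonoidOf (⊤ : AddSubmonoid M)).surj x
  exact ⟨p, q, sub_eq_of_eq_add h.symm⟩

@[simp]
theorem gpMap_of {P Q : Type*} [AddCommMonoid P] [AddCommMonoid Q] (θ : P →+ Q) (p : P) :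
    gpMap θ (GrothendieckAddGroup.of p) = GrothendieckAddGroup.of (θ p) :=
  DFunLike.congr_fun (GrothendieckAddGroup.lift.symm_apply_apply
    ((GrothendieckAddGroup.of (M := Q)).comp θ)) p

/-- A submonoid of a cancellative monoid is exact if it is closed under differences. -/
theorem isExactSubmonoid_of_sub_mem {M : Type*} [AddCommMonoid M] [IsCancelAdd M]
    (S : AddSubmonoid M) (h : ∀ p ∈ S, ∀ q, p + q ∈ S → q ∈ S) : IsExactSubmonoid S := by
  intro x q hxq
  obtain ⟨a, b, rfl⟩ := exists_of_sub_of_eq x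
  rw [map_sub, gpMap_of, gpMap_of, sub_eq_iff_eq_add', ← map_add] at hxq
  have hab : (a : M) = b + q := GrothendieckAddGroup.of_injective hxq
  have hq : q ∈ S := h b b.2 q (hab ▸ a.2)
  refine ⟨⟨q, hq⟩, ⟨?_, rfl⟩, fun p hp => Subtype.ext hp.2⟩
  rw [eq_sub_iff_add_eq', ← map_add]
  exact congrArg _ (Subtype.ext hab.symm)

/-- The homomorphism to `ℕ ^ r` defined by functionals on the group completion which are
nonnegative on the monoid. -/
def toNatPi {Q : Type*} [AddCommMonoid Q] {r : ℕ} (φ : Fin r → GrothendieckAddGroup Q →+ ℤ)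
    (hφ : ∀ q i, 0 ≤ φ i (GrothendieckAddGroup.of q)) : Q →+ (Fin r → ℕ) where
  toFun q i := (φ i (GrothendieckAddGroup.of q)).toNat
  map_zero' := by ext i; simp
  map_add' p q := by
    ext i
    rw [map_add, map_add, Int.toNat_add (hφ p i) (hφ q i), Pi.add_apply]

theorem natCast_toNatPi {Q : Type*} [AddCommMonoid Q] {r : ℕ}
    (φ : Fin r → GrothendieckAddGroup Q →+ ℤ)
    (hφ : ∀ q i, 0 ≤ φ i (GrothendieckAddGroup.of q)) (q : Q) (i : Fin r) :
    (toNatPi φ hφ q i : ℤ) = φ i (GrothendieckAddGroup.of q) :=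
  Int.toNat_of_nonneg (hφ q i)

/-- An injective homomorphism of monoids is an isomorphism onto its range. -/
noncomputable def addEquivMrange {P M : Type*} [AddCommMonoid P] [AddCommMonoid M] (f : P →+ M)
    (hf : Function.Injective f) : P ≃+ AddMonoidHom.mrange f :=
  AddEquiv.ofBijective f.mrangeRestrict
    ⟨fun _ _ h => hf (congrArg Subtype.val h), f.mrangeRestrict_surjective⟩

end CommMonoidGeometry

open CommMonoidGeometry in
theorem mainTheorem3 {Q : Type*} [AddCommMonoid Q]
    (hfine : CommMonoidGeometry.IsFine Q) (hsharp : CommMonoidGeometry.IsSharp Q) :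
    (∃ (r : ℕ) (T : Type) (_ : AddCommGroup T) (_ : Finite T)
        (S : AddSubmonoid ((Fin r → ℕ) × T)), Nonempty (Q ≃+ S)) ∧
    (IsAddTorsionFree (GrothendieckAddGroup Q) →
      ∃ (r : ℕ) (S : AddSubmonoid (Fin r → ℕ)), Nonempty (Q ≃+ S)) ∧
    (CommMonoidGeometry.IsSaturated Q →
      ∃ (r : ℕ) (S : AddSubmonoid (Fin r → ℕ)),
        CommMonoidGeometry.IsExactSubmonoid S ∧ Nonempty (Q ≃+ S)) := by
  have := hfine.integral
  have := hfine.fg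
  obtain ⟨r, φ, hφ⟩ := hfine.exists_nonneg_iff_nsmul_mem_range
  have hpos (q : Q) (i : Fin r) : 0 ≤ φ i (GrothendieckAddGroup.of q) :=
    (hφ _).mpr ⟨1, one_pos, q, (one_nsmul _).symm⟩ i
  have htors {p q : Q} (hpq : toNatPi φ hpos p = toNatPi φ hpos q) :
      ∃ n : ℕ, 0 < n ∧ n • (GrothendieckAddGroup.of p - GrothendieckAddGroup.of q) = 0 := by
    have h₀ (i : Fin r) : φ i (GrothendieckAddGroup.of p - GrothendieckAddGroup.of q) = 0 := by
      rw [map_sub, ← natCast_toNatPi φ hpos, ← natCast_toNatPi φ hpos, hpq, sub_self]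
    refine hsharp.exists_nsmul_eq_zero ((hφ _).mp fun i => (h₀ i).ge) ((hφ _).mp fun i => ?_)
    rw [map_neg, h₀, neg_zero]
  have hinj (htf : ∀ (x : GrothendieckAddGroup Q) (n : ℕ), 0 < n → n • x = 0 → x = 0) :
      Function.Injective (toNatPi φ hpos) := fun p q hpq => by
    obtain ⟨n, hn, h⟩ := htors hpq
    exact GrothendieckAddGroup.of_injective (sub_eq_zero.mp (htf _ n hn h))
  refine ⟨?_, fun htf => ?_, fun hsat => ?_⟩
  · have : AddGroup.FG (GrothendieckAddGroup Q) := AddGroup.fg_iff_addMonoid_fg.mpr inferInstance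
    obtain ⟨k, T, _, hT, ⟨e⟩⟩ := exists_addEquiv_free_prod_finite (GrothendieckAddGroup Q)
    let ψ : Q →+ T := (AddMonoidHom.snd (Fin k →₀ ℤ) T).comp
      (e.toAddMonoidHom.comp (GrothendieckAddGroup.of (M := Q)))
    refine ⟨r, T, _, hT, AddMonoidHom.mrange ((toNatPi φ hpos).prod ψ),
      ⟨addEquivMrange ((toNatPi φ hpos).prod ψ) fun p q hpq => ?_⟩⟩
    obtain ⟨h₁, h₂⟩ := Prod.ext_iff.mp hpq
    obtain ⟨n, hn, h⟩ := htors h₁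
    -- The difference is torsion, so the free components agree; `ψ` compares the finite ones.
    refine GrothendieckAddGroup.of_injective (e.injective (Prod.ext ?_ h₂))
    have := congrArg (fun x => (e x).1) h
    simp only [map_nsmul, map_sub, map_zero, Prod.smul_fst, Prod.fst_sub, Prod.fst_zero] at this
    exact sub_eq_zero.mp ((smul_eq_zero.mp this).resolve_left hn.ne')
  · exact ⟨r, _, ⟨addEquivMrange _ (hinj fun x n hn hx =>
      (nsmul_eq_zero_iff_right hn.ne').mp hx)⟩⟩
  · refine ⟨r, AddMonoidHom.mrange (toNatPi φ hpos), isExactSubmonoid_of_sub_mem _ ?_,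
      ⟨addEquivMrange _ (hinj fun x n hn hx => hsat.eq_zero_of_nsmul_eq_zero hsharp hn hx)⟩⟩
    rintro _ ⟨b, rfl⟩ v ⟨a, ha⟩
    -- The coordinates of `v` are the values of `φ` at `a - b`; being nonnegative, they put `a - b`
    -- in the saturation, which is `Q`.
    have hv (i : Fin r) : φ i (GrothendieckAddGroup.of a - GrothendieckAddGroup.of b) = v i := by
      rw [map_sub, ← natCast_toNatPi φ hpos, ← natCast_toNatPi φ hpos, ha, Pi.add_apply,
        Nat.cast_add, add_sub_cancel_left]
    obtain ⟨n, hn, hmem⟩ := (hφ _).mp fun i => (hv i).symm ▸ Int.natCast_nonneg (v i)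
    obtain ⟨c, hc⟩ := hsat.mem_of_nsmul_mem n _ hn hmem
    refine ⟨c, funext fun i => Int.natCast_inj.mp ?_⟩
    rw [natCast_toNatPi, hc, hv]
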